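/- Let $(U_p)_p$, indexed by the prime numbers $p$, be independent random variables, each uniformly distributed on the unit circle $\{u\in\mathbb{C} : |u|=1\}$, and for $n\in\mathbb{N}$ let $$X_n = -\sum_{p\le n}\log\!\left(1-\frac{U_p}{\sqrt p}\right),$$ where the sum runs over the prime numbers $p\le n$ and $\log$ is the principal branch of the logarithm. Let $m$ denote the Lebesgue measure on $\mathbb{C}\cong\mathbb{R}^2$. Then for every $\delta\in(0,1)$, every $z\in\mathbb{C}$, and every Jordan measurable set $B\subset\mathbb{C}$ (that is, $B$ is bounded and measurable, and its boundary satisfies $m(\partial B)=0$) with $m(B)>0$, $$\lim_{n\to\infty}(\log\log n)^{2\delta}\;\mathbb{P}\!\left[X_n - z\sqrt{\log\log n}\in(\log\log n)^{\frac12-\delta}B\right]=\frac{\mathrm{e}^{-|z|^2}}{\pi}\,m(B).$$ -/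

import Mathlib

open MeasureTheory ProbabilityTheory Filter
open scoped Topology Pointwise

/-- The uniform probability law on the unit circle of `ℂ`: the law of `exp (i θ)`, where `θ` is
uniformly distributed on the interval `(0, 2π]`. -/
noncomputable def uniformCircleLaw : Measure ℂ :=
  (ProbabilityTheory.cond (volume : Measure ℝ) (Set.Ioc 0 (2 * Real.pi))).map
    (fun θ : ℝ => Complex.exp (θ * Complex.I))

/-- Jordan measurable subsets of the plane: bounded (Lebesgue) measurable sets whose boundary has
zero Lebesgue measure. -/
structure IsJordanMeasurable (B : Set ℂ) : Prop where
  bounded : Bornology.IsBounded B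
  measurable : NullMeasurableSet B volume
  volume_frontier : volume (frontier B) = 0

/-- The logarithm of the random zeta function, `- ∑_{p ≤ n} log (1 - U_p / √p)`, where the sum runs
over the prime numbers `p ≤ n`, and `log` is the principal branch of the logarithm. -/
noncomputable def randomLogZeta {Ω : Type*} (U : Nat.Primes → Ω → ℂ) (n : ℕ) (ω : Ω) : ℂ :=
  - ∑ p ∈ (Finset.Iic n).subtype Nat.Prime,
      Complex.log (1 - U p ω / (Real.sqrt (p : ℕ) : ℂ))

/-!
Write `L = log log n` and `X` for `randomLogZeta U n`. The proof is a local limit theorem obtained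
from Fourier analysis.

For a Schwartz function `f`, Fourier inversion and Fubini's theorem express the expectation of
`f ((X - z √L) / L ^ (1/2 - δ))` through the characteristic function of `X`
(`integral_schwartz_comp_eq`). Rescaling the frequency by `L ^ (-δ)` produces exactly the factor
`L ^ (2 δ)`, and what remains is the integral over `w` of

`𝓕 f (L ^ (-δ) w) * exp (- 2 π i ⟨w, z⟩) * (the characteristic function of X at 2 π w / √L)`.

By the central limit theorem (`tendsto_zetaCharFun`) the integrand converges to
`𝓕 f 0 * exp (- 2 π i ⟨w, z⟩) * exp (- π² |w|²)`, whose integral is `(∫ f) * exp (-|z|²) / π`. The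
convergence is dominated. If `|ξ| ≤ √L`, then the characteristic function of `X` at `ξ` is at most
`exp (-|ξ|² L / 32)` in absolute value (`eventually_norm_zetaCharFun_le`), which covers
`2 π |w| ≤ L`. If `2 π |w| > L`, then `L ^ (-δ) |w|` is at least a positive power of `|w|` because
`δ < 1`, and the rapid decay of `𝓕 f` suffices (`exists_norm_schwartz_le_of_le`).

Both facts about the characteristic function rest on independence and on a second-order expansion
for a single prime, `1 - |ξ|² / (4 p) + O ((1 + |ξ|) |ξ|² p ^ (-3/2))`
(`norm_charFun_logFactor_sub_le`), where the mean value property of holomorphic functions removes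
the first-order term. They also use that the sum of `1 / p` over the primes `p ≤ n` is asymptotic to
`L` (`tendsto_sum_primesBelow_inv_div_log_log`).
-/

/-! ### Reciprocals of the primes -/

/-- The completely multiplicative function `n ↦ n ^ (-s)` on the natural numbers. -/
noncomputable def natRpowHom (s : ℝ) : ℕ →* ℝ where
  toFun n := (n : ℝ) ^ (-s)
  map_one' := by simp
  map_mul' m n := by
    push_cast
    exact Real.mul_rpow (Nat.cast_nonneg m) (Nat.cast_nonneg n)

lemma natRpowHom_prime_lt_one {s : ℝ} (hs : 0 < s) {p : ℕ} (hp : p.Prime) :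
    ‖natRpowHom s p‖ < 1 := by
  have h1 : (1 : ℝ) < p := by exact_mod_cast hp.one_lt
  change ‖(p : ℝ) ^ (-s)‖ < 1
  rw [Real.norm_of_nonneg (by positivity)]
  exact Real.rpow_lt_one_of_one_lt_of_neg h1 (by linarith)

/-- An upper bound for the prime sum `∑ p ^ (-s)` by the logarithm of the zeta function, through the
Euler product over the primes below `N`. -/
lemma sum_primesBelow_rpow_le_log_tsum {s : ℝ} (hs : 1 < s) (N : ℕ) :
    ∑ p ∈ N.primesBelow, (p : ℝ) ^ (-s) ≤ Real.log (∑' m : ℕ, 1 / (m : ℝ) ^ s) := by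
  have hs0 : 0 < s := by linarith
  have hsum : Summable (fun m : ℕ => 1 / (m : ℝ) ^ s) := Real.summable_one_div_nat_rpow.2 hs
  have hE := (EulerProduct.summable_and_hasSum_smoothNumbers_prod_primesBelow_geometric
    (f := natRpowHom s) (fun hp => natRpowHom_prime_lt_one hs0 hp) N).2
  have hlt : ∀ p ∈ N.primesBelow, (p : ℝ) ^ (-s) < 1 := by
    intro p hp
    have := natRpowHom_prime_lt_one hs0 (Nat.prime_of_mem_primesBelow hp)
    exact lt_of_le_of_lt (le_abs_self _) this
  have hle : ∏ p ∈ N.primesBelow, (1 - (p : ℝ) ^ (-s))⁻¹ ≤ ∑' m : ℕ, 1 / (m : ℝ) ^ s := by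
    have h2 := hE.tsum_eq
    have h3 : ∏ p ∈ N.primesBelow, (1 - (p : ℝ) ^ (-s))⁻¹
        = ∑' m : N.smoothNumbers, 1 / ((m : ℕ) : ℝ) ^ s := by
      refine h2.symm.trans (tsum_congr fun m => ?_)
      change ((m : ℕ) : ℝ) ^ (-s) = _
      rw [Real.rpow_neg (by positivity), one_div]
    rw [h3]
    exact hsum.tsum_subtype_le _ _ (fun m => by positivity)
  have hpos : 0 < ∏ p ∈ N.primesBelow, (1 - (p : ℝ) ^ (-s))⁻¹ :=
    Finset.prod_pos fun p hp => inv_pos.2 (by linarith [hlt p hp])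
  refine le_trans ?_ (Real.log_le_log hpos hle)
  rw [Real.log_prod (fun p hp => (inv_pos.2 (by linarith [hlt p hp])).ne')]
  refine Finset.sum_le_sum fun p hp => ?_
  rw [Real.log_inv]
  linarith [Real.log_le_sub_one_of_pos (show 0 < 1 - (p : ℝ) ^ (-s) by linarith [hlt p hp])]

/-- Expanding the Euler product at exponent `1` over the primes up to `n` gives all the terms of the
harmonic sum up to `n`. -/
lemma log_le_prod_primesBelow (n : ℕ) :
    Real.log (n + 1) ≤ ∏ p ∈ (n + 1).primesBelow, (1 - (p : ℝ)⁻¹)⁻¹ := by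
  obtain ⟨hS, hE⟩ := EulerProduct.summable_and_hasSum_smoothNumbers_prod_primesBelow_geometric
    (f := natRpowHom 1) (fun hp => natRpowHom_prime_lt_one one_pos hp) (n + 1)
  have hf : ∀ m : ℕ, natRpowHom 1 m = (m : ℝ)⁻¹ := fun m => Real.rpow_neg_one _
  simp only [hf] at hS hE
  have h1 := log_add_one_le_harmonic n
  push_cast at h1
  refine h1.trans ?_
  rw [harmonic_eq_sum_Icc]
  push_cast
  have hmem : ∀ m ∈ Finset.Icc 1 n, m ∈ (n + 1).smoothNumbers := by
    intro m hm
    rw [Finset.mem_Icc] at hm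
    exact Nat.mem_smoothNumbers_of_lt (by omega) (by omega)
  have h2 : ∑ m ∈ Finset.Icc 1 n, (m : ℝ)⁻¹
      = ∑ m ∈ (Finset.Icc 1 n).subtype (· ∈ (n + 1).smoothNumbers), ((m : ℕ) : ℝ)⁻¹ :=
    (Finset.sum_subtype_of_mem (fun m : ℕ => (m : ℝ)⁻¹) hmem).symm
  rw [h2]
  exact sum_le_hasSum _ (fun m _ => by positivity) hE

lemma log_log_le_sum_primesBelow_inv :
    ∃ C : ℝ, ∀ n : ℕ, 2 ≤ n →
      Real.log (Real.log n) - C ≤ ∑ p ∈ (n + 1).primesBelow, (p : ℝ)⁻¹ := by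
  have hsum : Summable (fun m : ℕ => ((m : ℝ) ^ 2)⁻¹) :=
    Real.summable_nat_pow_inv.2 one_lt_two
  refine ⟨2 * ∑' m : ℕ, ((m : ℝ) ^ 2)⁻¹, fun n hn => ?_⟩
  have hn1 : (1 : ℝ) < n := by exact_mod_cast hn
  have hp2 : ∀ p ∈ (n + 1).primesBelow, (2 : ℝ) ≤ p := fun p hp => by
    exact_mod_cast (Nat.prime_of_mem_primesBelow hp).two_le
  have hpinv : ∀ p ∈ (n + 1).primesBelow, (p : ℝ)⁻¹ ≤ 1 / 2 := fun p hp => by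
    rw [one_div]
    exact inv_anti₀ two_pos (hp2 p hp)
  have h1 : Real.log (Real.log n) ≤ Real.log (∏ p ∈ (n + 1).primesBelow, (1 - (p : ℝ)⁻¹)⁻¹) :=
    Real.log_le_log (Real.log_pos hn1)
      ((Real.log_le_log (by linarith) (by linarith)).trans (log_le_prod_primesBelow n))
  rw [Real.log_prod (fun p hp => (inv_pos.2 (by linarith [hpinv p hp])).ne')] at h1
  have h2 : ∑ p ∈ (n + 1).primesBelow, Real.log ((1 - (p : ℝ)⁻¹)⁻¹)
      ≤ ∑ p ∈ (n + 1).primesBelow, ((p : ℝ)⁻¹ + 2 * ((p : ℝ) ^ 2)⁻¹) := by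
    refine Finset.sum_le_sum fun p hp => ?_
    have h0 := hp2 p hp
    have h3 := hpinv p hp
    refine (Real.log_le_sub_one_of_pos (inv_pos.2 (by linarith))).trans ?_
    set x := (p : ℝ)⁻¹ with hx
    have hx0 : 0 < x := by positivity
    have : ((p : ℝ) ^ 2)⁻¹ = x ^ 2 := by rw [hx, inv_pow]
    rw [this, sub_le_iff_le_add, inv_le_iff_one_le_mul₀ (by linarith)]
    nlinarith [sq_nonneg x]
  have h4 : ∑ p ∈ (n + 1).primesBelow, ((p : ℝ) ^ 2)⁻¹ ≤ ∑' m : ℕ, ((m : ℝ) ^ 2)⁻¹ :=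
    hsum.sum_le_tsum _ (fun m _ => by positivity)
  rw [Finset.sum_add_distrib, ← Finset.mul_sum] at h2
  linarith

/-- With `s = 1 + 1 / (log n * log log n)`, each `1 / p` with `p ≤ n` exceeds `p ^ (-s)` by a factor
of at most `exp (1 / log log n)`, while the zeta function at `s` is at most `2 / (s - 1)`. -/
lemma sum_primesBelow_inv_le :
    ∀ᶠ n : ℕ in atTop, ∑ p ∈ (n + 1).primesBelow, (p : ℝ)⁻¹ ≤
      Real.exp (Real.log (Real.log n))⁻¹ *
        (Real.log 2 + Real.log (Real.log (Real.log n)) + Real.log (Real.log n)) := by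
  have hlog : Tendsto (fun n : ℕ => Real.log n) atTop atTop :=
    Real.tendsto_log_atTop.comp tendsto_natCast_atTop_atTop
  have hloglog : Tendsto (fun n : ℕ => Real.log (Real.log n)) atTop atTop :=
    Real.tendsto_log_atTop.comp hlog
  have hs : Tendsto (fun n : ℕ => 1 + (Real.log (Real.log n) * Real.log n)⁻¹) atTop (𝓝[>] 1) := by
    refine tendsto_nhdsWithin_iff.2 ⟨?_, ?_⟩
    · simpa using (tendsto_inv_atTop_zero.comp (hloglog.atTop_mul_atTop₀ hlog)).const_add 1
    · filter_upwards [hlog.eventually_gt_atTop 0, hloglog.eventually_gt_atTop 0] with n h1 h2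
      have : 0 < (Real.log (Real.log n) * Real.log n)⁻¹ := by positivity
      exact lt_add_of_pos_right 1 this
  have hz := (tendsto_sub_mul_tsum_nat_rpow.comp hs).eventually_le_const one_lt_two
  filter_upwards [hz, hlog.eventually_gt_atTop 0, hloglog.eventually_gt_atTop 0] with n hn h1 h2
  simp only [Function.comp_apply] at hn
  set ℓ := Real.log n with hℓ
  set L := Real.log ℓ with hL
  have hε : 0 < (L * ℓ)⁻¹ := by positivity
  have hs1 : 1 < 1 + (L * ℓ)⁻¹ := by linarith
  have hsum : Summable (fun m : ℕ => 1 / (m : ℝ) ^ (1 + (L * ℓ)⁻¹)) :=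
    Real.summable_one_div_nat_rpow.2 hs1
  have hzpos : 0 < ∑' m : ℕ, 1 / (m : ℝ) ^ (1 + (L * ℓ)⁻¹) :=
    hsum.tsum_pos (fun m => by positivity) 1 (by simp)
  have hzle : ∑' m : ℕ, 1 / (m : ℝ) ^ (1 + (L * ℓ)⁻¹) ≤ 2 * (L * ℓ) := by
    rw [add_sub_cancel_left, inv_mul_le_iff₀ (by positivity)] at hn
    linarith
  have h3 := (sum_primesBelow_rpow_le_log_tsum hs1 (n + 1)).trans (Real.log_le_log hzpos hzle)
  rw [Real.log_mul two_ne_zero (by positivity), Real.log_mul h2.ne' h1.ne', ← hL] at h3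
  have hbound : ∑ p ∈ (n + 1).primesBelow, (p : ℝ)⁻¹
      ≤ Real.exp L⁻¹ * ∑ p ∈ (n + 1).primesBelow, (p : ℝ) ^ (-(1 + (L * ℓ)⁻¹)) := by
    rw [Finset.mul_sum]
    refine Finset.sum_le_sum fun p hp => ?_
    have hp0 : (0 : ℝ) < p := by exact_mod_cast (Nat.prime_of_mem_primesBelow hp).pos
    have hpn : (p : ℝ) ≤ n := by
      exact_mod_cast Nat.lt_succ_iff.1 (Nat.lt_of_mem_primesBelow hp)
    have hlp : Real.log p ≤ ℓ := Real.log_le_log hp0 hpn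
    have e1 : (p : ℝ) ^ (-(1 + (L * ℓ)⁻¹)) = (p : ℝ)⁻¹ * Real.exp (-(Real.log p * (L * ℓ)⁻¹)) := by
      rw [neg_add, Real.rpow_add hp0, Real.rpow_neg_one, Real.rpow_def_of_pos hp0, mul_neg]
    rw [e1, mul_left_comm, ← Real.exp_add]
    refine le_mul_of_one_le_right (by positivity) (Real.one_le_exp ?_)
    have : Real.log p * (L * ℓ)⁻¹ ≤ ℓ * (L * ℓ)⁻¹ := by gcongr
    have e2 : ℓ * (L * ℓ)⁻¹ = L⁻¹ := by field_simp
    linarith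
  refine hbound.trans (mul_le_mul_of_nonneg_left ?_ (Real.exp_pos _).le)
  linarith

/-- A weak form of Mertens' second theorem. The lower bound compares the harmonic series with a
finite Euler product; the upper bound evaluates the zeta function at `1 + 1 / (log n * log log n)`. -/
theorem tendsto_sum_primesBelow_inv_div_log_log :
    Tendsto (fun n : ℕ => (∑ p ∈ (n + 1).primesBelow, (p : ℝ)⁻¹) / Real.log (Real.log n))
      atTop (𝓝 1) := by
  have hloglog : Tendsto (fun n : ℕ => Real.log (Real.log n)) atTop atTop :=
    Real.tendsto_log_atTop.comp (Real.tendsto_log_atTop.comp tendsto_natCast_atTop_atTop)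
  obtain ⟨C, hC⟩ := log_log_le_sum_primesBelow_inv
  have hlow : Tendsto (fun x : ℝ => 1 - C * x⁻¹) atTop (𝓝 1) := by
    simpa using (tendsto_inv_atTop_zero.const_mul C).const_sub (1 : ℝ)
  have hup : Tendsto (fun x : ℝ => Real.exp x⁻¹ * (Real.log 2 * x⁻¹ + Real.log x / x + 1))
      atTop (𝓝 1) := by
    have h1 : Tendsto (fun x : ℝ => Real.exp x⁻¹) atTop (𝓝 1) := by
      simpa [Function.comp_def] using
        (Real.continuous_exp.tendsto 0).comp (tendsto_inv_atTop_zero (𝕜 := ℝ))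
    have h2 : Tendsto (fun x : ℝ => Real.log x / x) atTop (𝓝 0) :=
      Real.isLittleO_log_id_atTop.tendsto_div_nhds_zero
    simpa using h1.mul (((tendsto_inv_atTop_zero.const_mul (Real.log 2)).add h2).add_const 1)
  refine tendsto_of_tendsto_of_tendsto_of_le_of_le' (hlow.comp hloglog) (hup.comp hloglog) ?_ ?_
  · filter_upwards [hloglog.eventually_gt_atTop 0, eventually_ge_atTop 2] with n h1 h2
    simp only [Function.comp_apply]
    rw [le_div_iff₀ h1, sub_mul, inv_mul_cancel_right₀ h1.ne', one_mul]
    exact hC n h2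
  · filter_upwards [hloglog.eventually_gt_atTop 0, sum_primesBelow_inv_le] with n h1 h2
    simp only [Function.comp_apply]
    rw [div_le_iff₀ h1]
    refine h2.trans (le_of_eq ?_)
    field_simp

/-! ### The uniform law on the unit circle -/

lemma integral_uniformCircleLaw {E : Type*} [NormedAddCommGroup E] [NormedSpace ℝ E]
    {f : ℂ → E} (hf : StronglyMeasurable f) :
    ∫ u, f u ∂uniformCircleLaw = Real.circleAverage f 0 1 := by
  have hm : Measurable (fun θ : ℝ => Complex.exp (θ * Complex.I)) := by fun_prop
  have hpi : (0 : ℝ) ≤ 2 * Real.pi := by positivity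
  rw [uniformCircleLaw, integral_map_of_stronglyMeasurable hm hf, ProbabilityTheory.cond,
    integral_smul_measure, Real.circleAverage_def, intervalIntegral.integral_of_le hpi]
  simp only [circleMap, zero_add, Complex.ofReal_one, one_mul, Real.volume_Ioc, sub_zero]
  rw [ENNReal.toReal_inv, ENNReal.toReal_ofReal hpi]

instance isProbabilityMeasure_uniformCircleLaw : IsProbabilityMeasure uniformCircleLaw := by
  have hm : Measurable (fun θ : ℝ => Complex.exp (θ * Complex.I)) := by fun_prop
  have : IsProbabilityMeasure
      (ProbabilityTheory.cond (volume : Measure ℝ) (Set.Ioc 0 (2 * Real.pi))) := by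
    refine ProbabilityTheory.cond_isProbabilityMeasure_of_finite ?_ ?_
    · simp [Real.pi_pos]
    · rw [Real.volume_Ioc]
      exact ENNReal.ofReal_ne_top
  exact Measure.isProbabilityMeasure_map hm.aemeasurable

lemma ae_norm_eq_one_uniformCircleLaw : ∀ᵐ u ∂uniformCircleLaw, ‖u‖ = 1 := by
  have hm : Measurable (fun θ : ℝ => Complex.exp (θ * Complex.I)) := by fun_prop
  rw [uniformCircleLaw, ae_map_iff hm.aemeasurable (measurableSet_eq_fun (by fun_prop) (by fun_prop))]
  exact Eventually.of_forall fun θ => Complex.norm_exp_ofReal_mul_I θ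

/-- The mean value property of holomorphic functions. -/
lemma integral_uniformCircleLaw_eq_apply_zero {f : ℂ → ℂ} (hf : StronglyMeasurable f)
    (hd : ∀ u : ℂ, ‖u‖ ≤ 1 → DifferentiableAt ℂ f u) :
    ∫ u, f u ∂uniformCircleLaw = f 0 := by
  rw [integral_uniformCircleLaw hf]
  refine DiffContOnCl.circleAverage (DifferentiableOn.diffContOnCl fun u hu => ?_)
  rw [abs_one, closure_ball _ one_ne_zero, mem_closedBall_zero_iff] at hu
  exact (hd u hu).differentiableWithinAt

/-- The contribution of one prime to the random zeta function: the function `u ↦ - log (1 - a u)`,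
where `a` stands for `p ^ (-1/2)`. -/
noncomputable def logFactor (a : ℝ) (u : ℂ) : ℂ := -Complex.log (1 - a * u)

@[fun_prop]
lemma measurable_logFactor (a : ℝ) : Measurable (logFactor a) := by
  unfold logFactor
  fun_prop

lemma norm_logFactor_sub_le {a : ℝ} (ha : 0 ≤ a) (ha' : a ≤ 3 / 4) {u : ℂ} (hu : ‖u‖ = 1) :
    ‖logFactor a u - a * u‖ ≤ 2 * a ^ 2 := by
  have hn : ‖-(a * u : ℂ)‖ = a := by
    rw [norm_neg, norm_mul, hu, mul_one, Complex.norm_of_nonneg ha]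
  have h := Complex.norm_log_one_add_sub_self_le (z := -(a * u : ℂ)) (by rw [hn]; linarith)
  rw [hn] at h
  have e : logFactor a u - a * u = -(Complex.log (1 + -(a * u : ℂ)) - -(a * u : ℂ)) := by
    rw [logFactor, ← sub_eq_add_neg]; ring
  rw [e, norm_neg]
  refine h.trans ?_
  have : (1 - a)⁻¹ ≤ 4 := by
    rw [inv_le_comm₀ (by linarith) (by norm_num)]; linarith
  nlinarith [sq_nonneg a]

lemma integral_logFactor {a : ℝ} (ha : 0 ≤ a) (ha' : a ≤ 3 / 4) :
    ∫ u, logFactor a u ∂uniformCircleLaw = 0 := by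
  rw [integral_uniformCircleLaw_eq_apply_zero (measurable_logFactor a).stronglyMeasurable]
  · simp [logFactor]
  · intro u hu
    refine (DifferentiableAt.clog (by fun_prop) ?_).neg
    refine Or.inl ?_
    have : (a * u : ℂ).re ≤ 3 / 4 := by
      refine (Complex.re_le_norm _).trans ?_
      rw [norm_mul, Complex.norm_of_nonneg ha]
      nlinarith
    rw [Complex.sub_re, Complex.one_re]
    linarith

lemma integral_sq_uniformCircleLaw : ∫ u : ℂ, u ^ 2 ∂uniformCircleLaw = 0 := by
  rw [integral_uniformCircleLaw_eq_apply_zero (f := fun u => u ^ 2)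
    (by fun_prop) (fun u _ => by fun_prop)]
  simp

/-- The real form of `cos θ ^ 2 = (1 + cos (2 θ)) / 2`, for the angle `θ` between `u` and `v`. -/
lemma inner_sq_complex (u v : ℂ) :
    (inner ℝ u v) ^ 2 = (‖u‖ ^ 2 * ‖v‖ ^ 2 + inner ℝ (v ^ 2) (u ^ 2)) / 2 := by
  rw [← Complex.normSq_eq_norm_sq, ← Complex.normSq_eq_norm_sq, Complex.inner, Complex.inner,
    Complex.normSq_apply, Complex.normSq_apply]
  simp only [pow_two, Complex.mul_re, Complex.mul_im, Complex.conj_re, Complex.conj_im]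
  ring

lemma integral_inner_sq_uniformCircleLaw (v : ℂ) :
    ∫ u : ℂ, (inner ℝ u v) ^ 2 ∂uniformCircleLaw = ‖v‖ ^ 2 / 2 := by
  have hi : Integrable (fun u : ℂ => u ^ 2) uniformCircleLaw := by
    refine Integrable.of_bound (by fun_prop) 1 ?_
    filter_upwards [ae_norm_eq_one_uniformCircleLaw] with u hu
    simp [hu]
  have h : ∫ u : ℂ, (inner ℝ u v) ^ 2 ∂uniformCircleLaw
      = ∫ u : ℂ, (‖v‖ ^ 2 / 2 + (2 : ℝ)⁻¹ * inner ℝ (v ^ 2) (u ^ 2)) ∂uniformCircleLaw := by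
    refine integral_congr_ae ?_
    filter_upwards [ae_norm_eq_one_uniformCircleLaw] with u hu
    rw [inner_sq_complex, hu]
    ring
  rw [h, integral_add (integrable_const _) ((hi.const_inner _).const_mul _), integral_const_mul,
    integral_inner hi, integral_sq_uniformCircleLaw]
  simp

/-- A second-order Taylor bound valid for all real `y`, with a constant that is not optimal. -/
lemma norm_exp_ofReal_mul_I_sub_taylor_le (y : ℝ) :
    ‖Complex.exp (y * Complex.I) - 1 - y * Complex.I + (y : ℂ) ^ 2 / 2‖ ≤ 4 * |y| ^ 3 := by
  have hI : ‖(y * Complex.I : ℂ)‖ = |y| := by simp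
  rcases le_or_gt |y| 1 with hy | hy
  · have h := Complex.norm_exp_sub_sum_le_norm_mul_exp (y * Complex.I) 3
    rw [hI] at h
    have e : Complex.exp (y * Complex.I) - 1 - y * Complex.I + (y : ℂ) ^ 2 / 2
        = Complex.exp (y * Complex.I)
          - ∑ m ∈ Finset.range 3, (y * Complex.I : ℂ) ^ m / (m.factorial : ℂ) := by
      simp [Finset.sum_range_succ, mul_pow]
      ring
    rw [e]
    refine h.trans ?_
    have h1 : Real.exp |y| ≤ 4 :=
      (Real.exp_le_exp.2 hy).trans (by linarith [Real.exp_one_lt_d9])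
    have h0 : 0 ≤ |y| ^ 3 := by positivity
    nlinarith
  · have h : ‖Complex.exp (y * Complex.I) - 1 - y * Complex.I + (y : ℂ) ^ 2 / 2‖
        ≤ 1 + 1 + |y| + |y| ^ 2 / 2 := by
      refine (norm_add_le _ _).trans (add_le_add ((norm_sub_le _ _).trans (add_le_add
        ((norm_sub_le _ _).trans (add_le_add ?_ ?_)) ?_)) ?_)
      · rw [Complex.norm_exp_ofReal_mul_I]
      · simp
      · rw [hI]
      · simp
    have h2 : |y| ≤ |y| ^ 3 := le_self_pow₀ hy.le (by norm_num)
    have h3 : |y| ^ 2 ≤ |y| ^ 3 := pow_le_pow_right₀ hy.le (by norm_num)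
    linarith

/-- Second-order expansion of the characteristic function of the contribution of one prime, uniform
in `a` and `ξ`. The first-order term vanishes because `logFactor a` is holomorphic and vanishes at
the origin. -/
lemma norm_charFun_logFactor_sub_le {a : ℝ} (ha : 0 ≤ a) (ha' : a ≤ 3 / 4) (ξ : ℂ) :
    ‖charFun (uniformCircleLaw.map (logFactor a)) ξ - (1 - ‖ξ‖ ^ 2 * a ^ 2 / 4 : ℝ)‖
      ≤ 112 * (1 + ‖ξ‖) * (‖ξ‖ ^ 2 * a ^ 3) := by
  set ν := uniformCircleLaw with hν
  set Y : ℂ → ℝ := fun u => inner ℝ (logFactor a u) ξ with hY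
  set A : ℂ → ℝ := fun u => inner ℝ (a * u) ξ with hA
  have hYm : Measurable Y := by fun_prop
  have hAm : Measurable A := by fun_prop
  have hle : ∀ u : ℂ, ‖u‖ = 1 → |A u| ≤ a * ‖ξ‖ ∧ |Y u - A u| ≤ 2 * a ^ 2 * ‖ξ‖ ∧
      |Y u| ≤ 3 * (a * ‖ξ‖) := by
    intro u hu
    have h1 : |A u| ≤ a * ‖ξ‖ := by
      refine (abs_real_inner_le_norm _ _).trans ?_
      rw [norm_mul, hu, mul_one, Complex.norm_of_nonneg ha]
    have h2 : |Y u - A u| ≤ 2 * a ^ 2 * ‖ξ‖ := by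
      rw [hY, hA]
      simp only [← inner_sub_left]
      refine (abs_real_inner_le_norm _ _).trans ?_
      gcongr
      exact norm_logFactor_sub_le ha ha' hu
    refine ⟨h1, h2, ?_⟩
    have h3 : |Y u| ≤ |Y u - A u| + |A u| := by
      simpa using abs_add_le (Y u - A u) (A u)
    have h4 : 2 * a ^ 2 * ‖ξ‖ ≤ 2 * (a * ‖ξ‖) := by
      have : a ^ 2 ≤ a := by nlinarith
      nlinarith [norm_nonneg ξ]
    linarith
  have hYi : Integrable Y ν := by
    refine Integrable.of_bound hYm.aestronglyMeasurable (3 * (a * ‖ξ‖)) ?_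
    filter_upwards [ae_norm_eq_one_uniformCircleLaw] with u hu
    exact (hle u hu).2.2
  have hYint : ∫ u, Y u ∂ν = 0 := by
    have hi : Integrable (logFactor a) ν := by
      refine Integrable.of_bound (measurable_logFactor a).aestronglyMeasurable
        (2 * a ^ 2 + a) ?_
      filter_upwards [ae_norm_eq_one_uniformCircleLaw] with u hu
      calc ‖logFactor a u‖ = ‖(logFactor a u - a * u) + a * u‖ := by simp
        _ ≤ _ := (norm_add_le _ _).trans (add_le_add (norm_logFactor_sub_le ha ha' hu) (by
          rw [norm_mul, hu, mul_one, Complex.norm_of_nonneg ha]))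
    simp only [hY, real_inner_comm]
    rw [integral_inner hi, integral_logFactor ha ha', inner_zero_right]
  have hA2i : Integrable (fun u => (A u) ^ 2) ν := by
    refine Integrable.of_bound (by fun_prop) ((a * ‖ξ‖) ^ 2) ?_
    filter_upwards [ae_norm_eq_one_uniformCircleLaw] with u hu
    rw [Real.norm_eq_abs, abs_pow]
    gcongr
    exact (hle u hu).1
  have hA2int : ∫ u, (A u) ^ 2 ∂ν = a ^ 2 * ‖ξ‖ ^ 2 / 2 := by
    have : ∀ u : ℂ, (A u) ^ 2 = a ^ 2 * (inner ℝ u ξ) ^ 2 := fun u => by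
      simp only [hA, ← Complex.real_smul, real_inner_smul_left, mul_pow]
    simp only [this, integral_const_mul]
    rw [integral_inner_sq_uniformCircleLaw]
    ring
  have hEi : Integrable (fun u => Complex.exp (Y u * Complex.I)) ν := by
    refine Integrable.of_bound (by fun_prop) 1 (Eventually.of_forall fun u => ?_)
    rw [Complex.norm_exp_ofReal_mul_I]
  have hchar : charFun (ν.map (logFactor a)) ξ = ∫ u, Complex.exp (Y u * Complex.I) ∂ν := by
    rw [charFun_apply, integral_map (measurable_logFactor a).aemeasurable (by fun_prop)]
  have hint : ∫ u, (Complex.exp (Y u * Complex.I) - 1 - Y u * Complex.I + ((A u) ^ 2 / 2 : ℝ)) ∂ν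
      = charFun (ν.map (logFactor a)) ξ - (1 - ‖ξ‖ ^ 2 * a ^ 2 / 4 : ℝ) := by
    have i1 : Integrable (fun u => (Y u : ℂ) * Complex.I) ν := hYi.ofReal.mul_const _
    have i2 : Integrable (fun u => (((A u) ^ 2 / 2 : ℝ) : ℂ)) ν := (hA2i.div_const 2).ofReal
    have i3 : Integrable (fun u => Complex.exp (Y u * Complex.I) - 1) ν :=
      hEi.sub (integrable_const 1)
    have i4 : Integrable (fun u => Complex.exp (Y u * Complex.I) - 1 - Y u * Complex.I) ν :=
      i3.sub i1
    rw [integral_add i4 i2, integral_sub i3 i1, integral_sub hEi (integrable_const 1),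
      integral_mul_const, integral_complex_ofReal, integral_complex_ofReal, hYint,
      integral_div, hA2int, hchar]
    simp
    ring
  rw [← hint]
  refine (norm_integral_le_of_norm_le_const (C := 112 * (1 + ‖ξ‖) * (‖ξ‖ ^ 2 * a ^ 3)) ?_).trans
    (by simp)
  filter_upwards [ae_norm_eq_one_uniformCircleLaw] with u hu
  obtain ⟨h1, h2, h3⟩ := hle u hu
  have e : Complex.exp (Y u * Complex.I) - 1 - Y u * Complex.I + ((A u) ^ 2 / 2 : ℝ)
      = (Complex.exp (Y u * Complex.I) - 1 - Y u * Complex.I + (Y u : ℂ) ^ 2 / 2)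
        + (((A u - Y u) * (A u + Y u) / 2 : ℝ) : ℂ) := by
    push_cast; ring
  rw [e]
  have h4 : ‖(((A u - Y u) * (A u + Y u) / 2 : ℝ) : ℂ)‖ ≤ 4 * (‖ξ‖ ^ 2 * a ^ 3) := by
    rw [Complex.norm_real, Real.norm_eq_abs, abs_div, abs_mul, abs_two, abs_sub_comm]
    have h5 : |A u + Y u| ≤ 4 * (a * ‖ξ‖) := (abs_add_le _ _).trans (by linarith)
    have h6 : |Y u - A u| * |A u + Y u| ≤ 2 * a ^ 2 * ‖ξ‖ * (4 * (a * ‖ξ‖)) := by gcongr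
    linarith
  have h7 : 4 * |Y u| ^ 3 ≤ 108 * (‖ξ‖ ^ 3 * a ^ 3) := by
    have : |Y u| ^ 3 ≤ (3 * (a * ‖ξ‖)) ^ 3 := by gcongr
    linarith
  have h8 : 0 ≤ ‖ξ‖ ^ 2 * a ^ 3 := by positivity
  have h9 : 0 ≤ ‖ξ‖ ^ 3 * a ^ 3 := by positivity
  refine (norm_add_le _ _).trans ((add_le_add
    (norm_exp_ofReal_mul_I_sub_taylor_le (Y u)) h4).trans ?_)
  linarith

/-- Gaussian decay of the characteristic function of the contribution of one prime, at the
frequencies that are small compared with `1 / a`. -/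
lemma norm_charFun_logFactor_le {a : ℝ} (ha : 0 ≤ a) {ξ : ℂ} (hξ : 896 * (1 + ‖ξ‖) * a ≤ 1) :
    ‖charFun (uniformCircleLaw.map (logFactor a)) ξ‖ ≤ Real.exp (-(‖ξ‖ ^ 2 * a ^ 2 / 8)) := by
  have hξ0 := norm_nonneg ξ
  have hmul : 0 ≤ ‖ξ‖ * a := by positivity
  have ha' : a ≤ 3 / 4 := by nlinarith
  have h := norm_charFun_logFactor_sub_le ha ha' ξ
  -- The constant `896 = 8 * 112` makes the error term at most half of the quadratic term.
  have h1 : 112 * (1 + ‖ξ‖) * (‖ξ‖ ^ 2 * a ^ 3) ≤ ‖ξ‖ ^ 2 * a ^ 2 / 8 := by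
    have : 0 ≤ ‖ξ‖ ^ 2 * a ^ 2 := by positivity
    nlinarith
  have h2 : ‖ξ‖ ^ 2 * a ^ 2 ≤ 1 := by
    have : ‖ξ‖ * a ≤ 1 := by nlinarith
    rw [← mul_pow]
    exact pow_le_one₀ hmul this
  have h3 : ‖((1 - ‖ξ‖ ^ 2 * a ^ 2 / 4 : ℝ) : ℂ)‖ = 1 - ‖ξ‖ ^ 2 * a ^ 2 / 4 :=
    Complex.norm_of_nonneg (by linarith)
  have h4 := norm_le_norm_add_norm_sub ((1 - ‖ξ‖ ^ 2 * a ^ 2 / 4 : ℝ) : ℂ)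
    (charFun (uniformCircleLaw.map (logFactor a)) ξ)
  rw [norm_sub_rev, h3] at h4
  linarith [Real.add_one_le_exp (-(‖ξ‖ ^ 2 * a ^ 2 / 8))]

/-! ### The characteristic function of the random zeta function -/

/-- The prime numbers `p ≤ n`. -/
def primesUpTo (n : ℕ) : Finset Nat.Primes := (Finset.Iic n).subtype Nat.Prime

/-- The characteristic function of `randomLogZeta U n`, as a product over the primes `p ≤ n`. -/
noncomputable def zetaCharFun (n : ℕ) (ξ : ℂ) : ℂ :=
  ∏ p ∈ primesUpTo n,
    charFun (uniformCircleLaw.map (logFactor (Real.sqrt (p : ℕ))⁻¹)) ξ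

lemma randomLogZeta_eq_sum {Ω : Type*} (U : Nat.Primes → Ω → ℂ) (n : ℕ) :
    randomLogZeta U n = fun ω => ∑ p ∈ primesUpTo n,
      logFactor (Real.sqrt (p : ℕ))⁻¹ (U p ω) := by
  ext ω
  change -∑ p ∈ primesUpTo n, Complex.log (1 - U p ω / (Real.sqrt (p : ℕ) : ℂ)) = _
  rw [← Finset.sum_neg_distrib]
  refine Finset.sum_congr rfl fun p _ => ?_
  rw [logFactor, Complex.ofReal_inv, div_eq_inv_mul]

lemma aemeasurable_randomLogZeta {Ω : Type*} [MeasurableSpace Ω] {P : Measure Ω}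
    {U : Nat.Primes → Ω → ℂ} (hU : ∀ p, AEMeasurable (U p) P) (n : ℕ) :
    AEMeasurable (randomLogZeta U n) P := by
  rw [randomLogZeta_eq_sum]
  exact Finset.aemeasurable_fun_sum _ fun p _ => (measurable_logFactor _).comp_aemeasurable (hU p)

lemma charFun_randomLogZeta {Ω : Type*} [MeasurableSpace Ω] {P : Measure Ω}
    [IsProbabilityMeasure P] {U : Nat.Primes → Ω → ℂ}
    (hU_law : ∀ p, HasLaw (U p) uniformCircleLaw P) (hU_indep : iIndepFun U P) (n : ℕ) (ξ : ℂ) :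
    charFun (P.map (randomLogZeta U n)) ξ = zetaCharFun n ξ := by
  have hm : ∀ p, AEMeasurable (U p) P := fun p => (hU_law p).aemeasurable
  have hind : iIndepFun (fun (p : Nat.Primes) ω => logFactor (Real.sqrt (p : ℕ))⁻¹ (U p ω)) P :=
    hU_indep.comp (fun p : Nat.Primes => logFactor (Real.sqrt (p : ℕ))⁻¹)
      fun p => measurable_logFactor _
  rw [randomLogZeta_eq_sum, iIndepFun.charFun_map_fun_finsetSum_eq_prod
    (X := fun (p : Nat.Primes) ω => logFactor (Real.sqrt (p : ℕ))⁻¹ (U p ω))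
    (fun p _ => (measurable_logFactor _).comp_aemeasurable (hm p)) (hind.restrict _),
    zetaCharFun, Finset.prod_apply]
  refine Finset.prod_congr rfl fun p _ => ?_
  rw [← (hU_law p).map_eq, AEMeasurable.map_map_of_aemeasurable
    (measurable_logFactor _).aemeasurable (hm p)]
  rfl

lemma norm_charFun_map_logFactor_le_one (a : ℝ) (ξ : ℂ) :
    ‖charFun (uniformCircleLaw.map (logFactor a)) ξ‖ ≤ 1 := by
  have := Measure.isProbabilityMeasure_map (μ := uniformCircleLaw)
    (measurable_logFactor a).aemeasurable
  exact norm_charFun_le_one (μ := uniformCircleLaw.map (logFactor a)) ξ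

lemma norm_zetaCharFun_le_one (n : ℕ) (ξ : ℂ) : ‖zetaCharFun n ξ‖ ≤ 1 := by
  rw [zetaCharFun, norm_prod]
  exact Finset.prod_le_one (fun _ _ => norm_nonneg _)
    fun p _ => norm_charFun_map_logFactor_le_one _ _

lemma measurable_zetaCharFun (n : ℕ) : Measurable (zetaCharFun n) := by
  unfold zetaCharFun
  refine Finset.measurable_fun_prod _ fun p _ => ?_
  have := Measure.isProbabilityMeasure_map (μ := uniformCircleLaw)
    (measurable_logFactor (Real.sqrt (p : ℕ))⁻¹).aemeasurable
  exact measurable_charFun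

lemma norm_prod_sub_prod_le_sum {ι : Type*} (s : Finset ι) {f g : ι → ℂ}
    (hf : ∀ i ∈ s, ‖f i‖ ≤ 1) (hg : ∀ i ∈ s, ‖g i‖ ≤ 1) :
    ‖∏ i ∈ s, f i - ∏ i ∈ s, g i‖ ≤ ∑ i ∈ s, ‖f i - g i‖ := by
  classical
  induction s using Finset.induction_on with
  | empty => simp
  | insert j s hj ih =>
    rw [Finset.prod_insert hj, Finset.prod_insert hj, Finset.sum_insert hj]
    have h1 : ‖∏ i ∈ s, f i‖ ≤ 1 := by
      rw [norm_prod]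
      exact Finset.prod_le_one (fun _ _ => norm_nonneg _)
        fun i hi => hf i (Finset.mem_insert_of_mem hi)
    have h2 := ih (fun i hi => hf i (Finset.mem_insert_of_mem hi))
      (fun i hi => hg i (Finset.mem_insert_of_mem hi))
    have h3 := hg j (Finset.mem_insert_self j s)
    have e : f j * ∏ i ∈ s, f i - g j * ∏ i ∈ s, g i
        = (f j - g j) * ∏ i ∈ s, f i + g j * (∏ i ∈ s, f i - ∏ i ∈ s, g i) := by ring
    rw [e]
    refine (norm_add_le _ _).trans (add_le_add ?_ ?_)
    · rw [norm_mul]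
      exact mul_le_of_le_one_right (norm_nonneg _) h1
    · rw [norm_mul]
      exact (mul_le_of_le_one_left (norm_nonneg _) h3).trans h2

lemma sum_subtype_prime_eq_sum_primesBelow (n : ℕ) (f : ℕ → ℝ) :
    ∑ p ∈ primesUpTo n, f p = ∑ p ∈ (n + 1).primesBelow, f p := by
  refine (Finset.sum_subtype_eq_sum_filter f).trans (Finset.sum_congr ?_ fun _ _ => rfl)
  ext p
  simp [Nat.mem_primesBelow]

lemma tendsto_log_log_natCast_atTop :
    Tendsto (fun n : ℕ => Real.log (Real.log n)) atTop atTop :=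
  Real.tendsto_log_atTop.comp (Real.tendsto_log_atTop.comp tendsto_natCast_atTop_atTop)

lemma inv_sqrt_prime_le (p : Nat.Primes) : (Real.sqrt (p : ℕ))⁻¹ ≤ 3 / 4 := by
  have h2 : (2 : ℝ) ≤ (p : ℕ) := by exact_mod_cast p.2.two_le
  have : (4 / 3 : ℝ) ≤ Real.sqrt (p : ℕ) := Real.le_sqrt_of_sq_le (by norm_num; linarith)
  rw [inv_le_comm₀ (by linarith) (by norm_num)]
  linarith

lemma summable_inv_sqrt_pow_three : Summable fun m : ℕ => (Real.sqrt m)⁻¹ ^ 3 := by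
  refine (Real.summable_one_div_nat_rpow.2 (show (1 : ℝ) < 3 / 2 by norm_num)).congr fun m => ?_
  rw [Real.sqrt_eq_rpow, inv_pow, ← Real.rpow_natCast, ← Real.rpow_mul (Nat.cast_nonneg m), one_div]
  norm_num

/-- Comparison of `zetaCharFun` with a Gaussian whose variance is the sum of the reciprocals of the
primes. -/
lemma norm_zetaCharFun_sub_exp_le (n : ℕ) {ξ : ℂ} (hξ : ‖ξ‖ ≤ 1) :
    ‖zetaCharFun n ξ - Real.exp (-(‖ξ‖ ^ 2 / 4 * ∑ p ∈ (n + 1).primesBelow, (p : ℝ)⁻¹))‖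
      ≤ 225 * ‖ξ‖ ^ 2 * ∑' m : ℕ, (Real.sqrt m)⁻¹ ^ 3 := by
  rw [← sum_subtype_prime_eq_sum_primesBelow n (fun p => (p : ℝ)⁻¹), Finset.mul_sum,
    ← Finset.sum_neg_distrib, Real.exp_sum, Complex.ofReal_prod, zetaCharFun]
  refine (norm_prod_sub_prod_le_sum _ (fun p _ => norm_charFun_map_logFactor_le_one _ _) ?_).trans ?_
  · intro p _
    rw [Complex.norm_real, Real.norm_of_nonneg (Real.exp_pos _).le]
    exact Real.exp_le_one_iff.2 (neg_nonpos.2 (by positivity))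
  have hterm : ∀ p : Nat.Primes,
      ‖charFun (uniformCircleLaw.map (logFactor (Real.sqrt (p : ℕ))⁻¹)) ξ
        - (Real.exp (-(‖ξ‖ ^ 2 / 4 * ((p : ℕ) : ℝ)⁻¹)) : ℝ)‖
      ≤ 225 * ‖ξ‖ ^ 2 * (Real.sqrt (p : ℕ))⁻¹ ^ 3 := by
    intro p
    set a := (Real.sqrt (p : ℕ))⁻¹ with ha
    have ha0 : 0 ≤ a := by positivity
    have ha1 : a ≤ 3 / 4 := inv_sqrt_prime_le p
    have hp : ((p : ℕ) : ℝ)⁻¹ = a ^ 2 := by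
      rw [ha, inv_pow, Real.sq_sqrt (Nat.cast_nonneg _)]
    rw [hp]
    set x := ‖ξ‖ ^ 2 / 4 * a ^ 2 with hx
    have hξ0 := norm_nonneg ξ
    have hξ2 : ‖ξ‖ ^ 2 ≤ 1 := pow_le_one₀ hξ0 hξ
    have ha2 : a ^ 2 ≤ 1 := pow_le_one₀ ha0 (by linarith)
    have hx0 : 0 ≤ x := by positivity
    have hx1 : x ≤ 1 := by nlinarith
    have h1 := norm_charFun_logFactor_sub_le ha0 ha1 ξ
    have h2 := Real.norm_exp_sub_one_sub_id_le (x := -x)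
      (by rw [norm_neg, Real.norm_of_nonneg hx0]; exact hx1)
    rw [norm_neg, Real.norm_of_nonneg hx0] at h2
    have h3 : x ^ 2 ≤ ‖ξ‖ ^ 2 * a ^ 3 := by
      have e : x ^ 2 = (‖ξ‖ ^ 2 * a ^ 3) * (‖ξ‖ ^ 2 * a / 16) := by rw [hx]; ring
      rw [e]
      refine mul_le_of_le_one_right (by positivity) ?_
      nlinarith
    have h4 : 112 * (1 + ‖ξ‖) * (‖ξ‖ ^ 2 * a ^ 3) ≤ 224 * (‖ξ‖ ^ 2 * a ^ 3) := by
      gcongr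
      linarith
    have e : charFun (uniformCircleLaw.map (logFactor a)) ξ - (Real.exp (-x) : ℝ)
        = (charFun (uniformCircleLaw.map (logFactor a)) ξ - (1 - ‖ξ‖ ^ 2 * a ^ 2 / 4 : ℝ))
          - ((Real.exp (-x) - 1 - -x : ℝ) : ℂ) := by
      rw [hx]; push_cast; ring
    rw [e]
    refine (norm_sub_le _ _).trans ?_
    rw [Complex.norm_real (Real.exp (-x) - 1 - -x)]
    linarith
  refine (Finset.sum_le_sum fun p _ => hterm p).trans ?_
  rw [← Finset.mul_sum,
    sum_subtype_prime_eq_sum_primesBelow n (fun p => (Real.sqrt (p : ℕ))⁻¹ ^ 3)]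
  gcongr
  exact summable_inv_sqrt_pow_three.sum_le_tsum _ fun m _ => by positivity

/-- The central limit theorem for the random zeta function, in terms of characteristic functions. -/
lemma tendsto_zetaCharFun (ξ : ℂ) :
    Tendsto (fun n : ℕ => zetaCharFun n ((Real.sqrt (Real.log (Real.log n)))⁻¹ • ξ)) atTop
      (𝓝 (Real.exp (-(‖ξ‖ ^ 2 / 4)) : ℝ)) := by
  set η : ℕ → ℂ := fun n => (Real.sqrt (Real.log (Real.log n)))⁻¹ • ξ with hη
  set S : ℕ → ℝ := fun n => ∑ p ∈ (n + 1).primesBelow, (p : ℝ)⁻¹ with hS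
  have hη0 : Tendsto (fun n => ‖η n‖) atTop (𝓝 0) := by
    have h : Tendsto (fun n : ℕ => (Real.sqrt (Real.log (Real.log n)))⁻¹) atTop (𝓝 0) :=
      tendsto_inv_atTop_zero.comp (Real.tendsto_sqrt_atTop.comp tendsto_log_log_natCast_atTop)
    simpa only [zero_smul, norm_zero] using (h.smul_const ξ).norm
  have hvar : Tendsto (fun n => Real.exp (-(‖η n‖ ^ 2 / 4 * S n))) atTop
      (𝓝 (Real.exp (-(‖ξ‖ ^ 2 / 4)))) := by
    refine (Real.continuous_exp.tendsto _).comp (Tendsto.neg ?_)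
    have h := tendsto_sum_primesBelow_inv_div_log_log.const_mul (‖ξ‖ ^ 2 / 4)
    rw [mul_one] at h
    refine h.congr' ?_
    filter_upwards [tendsto_log_log_natCast_atTop.eventually_gt_atTop 0] with n hn
    rw [hη]
    simp only [norm_smul, norm_inv, Real.norm_of_nonneg (Real.sqrt_nonneg _), mul_pow, inv_pow,
      Real.sq_sqrt hn.le]
    ring
  have hdiff : Tendsto (fun n => zetaCharFun n (η n)
      - (Real.exp (-(‖η n‖ ^ 2 / 4 * S n)) : ℝ)) atTop (𝓝 0) := by
    rw [tendsto_zero_iff_norm_tendsto_zero]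
    have hb : Tendsto (fun n => 225 * ‖η n‖ ^ 2 * ∑' m : ℕ, (Real.sqrt m)⁻¹ ^ 3) atTop (𝓝 0) := by
      have h := ((hη0.pow 2).const_mul 225).mul_const (∑' m : ℕ, (Real.sqrt m)⁻¹ ^ 3)
      rwa [zero_pow two_ne_zero, mul_zero, zero_mul] at h
    refine squeeze_zero' (Eventually.of_forall fun _ => norm_nonneg _) ?_ hb
    filter_upwards [hη0.eventually_le_const one_pos] with n hn
    exact norm_zetaCharFun_sub_exp_le n hn
  have := hdiff.add ((Complex.continuous_ofReal.tendsto _).comp hvar)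
  simpa only [Function.comp_def, sub_add_cancel, zero_add] using this

lemma sum_inv_le_one_add_log {M : ℝ} (hM : 1 ≤ M) (s : Finset ℕ)
    (hs : ∀ m ∈ s, 1 ≤ m ∧ (m : ℝ) ≤ M) : ∑ m ∈ s, (m : ℝ)⁻¹ ≤ 1 + Real.log M := by
  refine le_trans ?_ (harmonic_floor_le_one_add_log M hM)
  rw [harmonic_eq_sum_Icc]
  push_cast
  refine Finset.sum_le_sum_of_subset_of_nonneg (fun m hm => ?_) fun _ _ _ => by positivity
  exact Finset.mem_Icc.2 ⟨(hs m hm).1, Nat.le_floor (hs m hm).2⟩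

/-- Uniform Gaussian decay of `zetaCharFun`. Only the primes that are large compared with `‖ξ‖ ^ 2`
contribute; the sum of the reciprocals of the other primes is `O (log log log n)`. -/
lemma eventually_norm_zetaCharFun_le :
    ∀ᶠ n : ℕ in atTop, ∀ ξ : ℂ, ‖ξ‖ ≤ Real.sqrt (Real.log (Real.log n)) →
      ‖zetaCharFun n ξ‖ ≤ Real.exp (-(‖ξ‖ ^ 2 * Real.log (Real.log n) / 32)) := by
  have hlog : ∀ c : ℝ, ∀ᶠ x : ℝ in atTop, c + Real.log x ≤ x / 4 := by
    intro c
    have h1 : Tendsto (fun x : ℝ => Real.log x / x) atTop (𝓝 0) :=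
      Real.isLittleO_log_id_atTop.tendsto_div_nhds_zero
    filter_upwards [h1.eventually_le_const (show (0 : ℝ) < 1 / 8 by norm_num),
      eventually_ge_atTop (8 * c), eventually_gt_atTop 0] with x hx1 hx2 hx3
    rw [div_le_iff₀ hx3] at hx1
    linarith
  filter_upwards [tendsto_log_log_natCast_atTop.eventually (hlog (1 + Real.log ((896 * 2) ^ 2))),
    tendsto_log_log_natCast_atTop.eventually_ge_atTop 1,
    tendsto_sum_primesBelow_inv_div_log_log.eventually_const_le
      (show (1 / 2 : ℝ) < 1 by norm_num)] with n h1 h2 h3 ξ hξ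
  set L := Real.log (Real.log n) with hL
  rw [le_div_iff₀ (by linarith)] at h3
  have hsqrt : 1 ≤ Real.sqrt L := Real.one_le_sqrt.2 h2
  set T := primesUpTo n with hT
  -- The one-prime bound `norm_charFun_logFactor_le` applies to the primes `p ≥ M ^ 2`.
  set M : ℝ := 896 * (1 + ‖ξ‖) with hM
  have hM1 : 1 ≤ M := by have := norm_nonneg ξ; linarith
  have hM2 : M ^ 2 ≤ (896 * 2) ^ 2 * L := by
    have : M ≤ 896 * 2 * Real.sqrt L := by linarith
    calc M ^ 2 ≤ (896 * 2 * Real.sqrt L) ^ 2 := by gcongr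
      _ = _ := by rw [mul_pow, Real.sq_sqrt (by linarith)]
  have hsmall : ∑ p ∈ (n + 1).primesBelow.filter (fun p : ℕ => ¬ M ^ 2 ≤ (p : ℝ)), (p : ℝ)⁻¹ ≤ L / 4 := by
    refine (sum_inv_le_one_add_log (M := M ^ 2) (one_le_pow₀ hM1) _ fun p hp => ?_).trans ?_
    · exact ⟨(Nat.prime_of_mem_primesBelow (Finset.mem_filter.1 hp).1).one_lt.le,
        (not_le.1 (Finset.mem_filter.1 hp).2).le⟩
    · refine le_trans ?_ h1
      rw [add_assoc, ← Real.log_mul (by norm_num) (by linarith)]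
      gcongr
  have hlarge : L / 4 ≤ ∑ p ∈ T, if M ^ 2 ≤ ((p : ℕ) : ℝ) then ((p : ℕ) : ℝ)⁻¹ else 0 := by
    have h5 := Finset.sum_filter_add_sum_filter_not (n + 1).primesBelow
      (fun p : ℕ => M ^ 2 ≤ (p : ℝ)) (fun p => (p : ℝ)⁻¹)
    rw [hT, sum_subtype_prime_eq_sum_primesBelow n
      (fun p => if M ^ 2 ≤ (p : ℝ) then (p : ℝ)⁻¹ else 0), ← Finset.sum_filter]
    linarith
  have hfac : ∀ p ∈ T, ‖charFun (uniformCircleLaw.map (logFactor (Real.sqrt (p : ℕ))⁻¹)) ξ‖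
      ≤ Real.exp (-(‖ξ‖ ^ 2 / 8 * if M ^ 2 ≤ ((p : ℕ) : ℝ) then ((p : ℕ) : ℝ)⁻¹ else 0)) := by
    intro p _
    split_ifs with hp
    · have h6 : M ≤ Real.sqrt (p : ℕ) := Real.le_sqrt_of_sq_le hp
      have h7 := norm_charFun_logFactor_le (a := (Real.sqrt (p : ℕ))⁻¹) (by positivity) (ξ := ξ)
        (by rw [← hM, ← div_eq_mul_inv]; exact div_le_one_of_le₀ h6 (by positivity))
      rw [inv_pow, Real.sq_sqrt (Nat.cast_nonneg _)] at h7
      refine h7.trans (le_of_eq ?_)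
      ring_nf
    · simpa using norm_charFun_map_logFactor_le_one _ _
  rw [zetaCharFun, norm_prod]
  refine (Finset.prod_le_prod (fun _ _ => norm_nonneg _) hfac).trans ?_
  rw [← Real.exp_sum, Finset.sum_neg_distrib, ← Finset.mul_sum]
  refine Real.exp_le_exp.2 (neg_le_neg ?_)
  have : ‖ξ‖ ^ 2 / 8 * (L / 4) = ‖ξ‖ ^ 2 * L / 32 := by ring
  rw [← this]
  gcongr

/-! ### Convergence against smooth test functions -/

open scoped FourierTransform

lemma SchwartzMap.exists_norm_pow_mul_norm_le {E F : Type*} [NormedAddCommGroup E]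
    [NormedSpace ℝ E] [NormedAddCommGroup F] [NormedSpace ℝ F] (f : SchwartzMap E F) (k : ℕ) :
    ∃ C, 0 < C ∧ ∀ x, ‖x‖ ^ k * ‖f x‖ ≤ C := by
  obtain ⟨C, hC, h⟩ := f.decay k 0
  exact ⟨C, hC, fun x => by simpa using h x⟩

lemma integrable_exp_neg_mul_norm_sq {b : ℝ} (hb : 0 < b) :
    Integrable (fun w : ℂ => Real.exp (-(b * ‖w‖ ^ 2))) := by
  have h := (GaussianFourier.integrable_cexp_neg_mul_sq_norm_add (V := ℂ) (b := b)
    (by simpa using hb) 0 0).norm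
  refine h.congr (Eventually.of_forall fun w => ?_)
  simp only [Complex.norm_exp]
  congr 1
  simp [← Complex.ofReal_pow, ← Complex.ofReal_neg, ← Complex.ofReal_mul]

/-- The Fourier transform of the Gaussian limit, written with the frequency `2 * π * w` at which
the limiting characteristic function is evaluated. -/
lemma integral_exp_neg_pi_sq_mul_cexp (z : ℂ) :
    ∫ w : ℂ, Complex.exp (-(2 * Real.pi * inner ℝ w z : ℝ) * Complex.I) *
      (Real.exp (-(‖(2 * Real.pi : ℝ) • w‖ ^ 2 / 4)) : ℝ)
      = (Real.exp (-‖z‖ ^ 2) / Real.pi : ℝ) := by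
  have hpi : (Real.pi : ℂ) ≠ 0 := by exact_mod_cast Real.pi_ne_zero
  have h := fourier_gaussian_innerProductSpace (V := ℂ) (b := (Real.pi ^ 2 : ℝ))
    (by rw [Complex.ofReal_re]; positivity) z
  rw [Real.fourier_eq'] at h
  refine Eq.trans (integral_congr_ae (Eventually.of_forall fun w => ?_)) (h.trans ?_)
  · simp only [smul_eq_mul, norm_smul]
    congr 1
    · congr 1; push_cast; ring
    · rw [Complex.ofReal_exp, Real.norm_of_nonneg (by positivity)]
      congr 1; push_cast; ring
  · rw [Complex.finrank_real_complex]
    push_cast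
    rw [div_self two_ne_zero, Complex.cpow_one]
    have e : -(Real.pi : ℂ) ^ 2 * (‖z‖ : ℂ) ^ 2 / (Real.pi : ℂ) ^ 2 = -(‖z‖ : ℂ) ^ 2 := by
      field_simp
    rw [e]
    field_simp

/-- Expectation of a test function of a rescaled random variable in terms of the characteristic
function of the variable: Fourier inversion and Fubini's theorem. -/
lemma integral_schwartz_comp_eq (μ : Measure ℂ) [IsProbabilityMeasure μ] (f : SchwartzMap ℂ ℂ)
    (c : ℂ) (s : ℝ) :
    ∫ x, f (s⁻¹ • (x - c)) ∂μ = ∫ v : ℂ, (𝓕 f) v *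
      (Complex.exp (-(2 * Real.pi * inner ℝ v (s⁻¹ • c) : ℝ) * Complex.I) *
        charFun μ ((2 * Real.pi * s⁻¹) • v)) := by
  have hF : Integrable (𝓕 f : SchwartzMap ℂ ℂ) := (𝓕 f).integrable
  have hinv : ∀ y, f y = ∫ v : ℂ, Complex.exp ((2 * Real.pi * inner ℝ v y : ℝ) * Complex.I) *
      (𝓕 f) v := by
    intro y
    have h := f.continuous.fourierInv_fourier_eq f.integrable
      (by rw [← SchwartzMap.fourier_coe]; exact hF)
    rw [← SchwartzMap.fourier_coe] at h
    have h2 := congrFun h y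
    rw [Real.fourierInv_eq'] at h2
    simpa only [smul_eq_mul] using h2.symm
  simp only [hinv]
  rw [integral_integral_swap]
  · refine integral_congr_ae (Eventually.of_forall fun v => ?_)
    simp only
    rw [integral_mul_const, mul_comm, charFun_apply,
      ← integral_const_mul (Complex.exp _)]
    congr 1
    refine integral_congr_ae (μ := μ) (Eventually.of_forall fun x => ?_)
    simp only [← Complex.exp_add]
    congr 1
    simp only [smul_sub, inner_sub_right, real_inner_smul_right, real_inner_comm v x]
    push_cast
    ring
  · have hg : Integrable (fun q : ℂ × ℂ => (𝓕 f) q.2) (μ.prod volume) := hF.comp_snd μ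
    refine hg.bdd_mul (c := 1) ?_ (Eventually.of_forall fun q => ?_)
    · have : Continuous fun q : ℂ × ℂ => Complex.exp
          ((2 * Real.pi * inner ℝ q.2 (s⁻¹ • (q.1 - c)) : ℝ) * Complex.I) := by fun_prop
      exact this.aestronglyMeasurable
    · rw [Complex.norm_exp_ofReal_mul_I]

/-- A rapidly decaying function of `L ^ (-δ) * w` decays polynomially in `w`, uniformly in `L`, on
the region `L ≤ 2 * π * ‖w‖`. -/
lemma exists_norm_schwartz_le_of_le (g : SchwartzMap ℂ ℂ) {δ : ℝ} (hδ : δ ∈ Set.Ioo (0 : ℝ) 1) :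
    ∃ C, 0 < C ∧ ∀ (L : ℝ) (w : ℂ), 1 ≤ L → L ≤ 2 * Real.pi * ‖w‖ →
      ‖g (L ^ (-δ) • w)‖ ≤ C * (1 + ‖w‖) ^ (-3 : ℝ) := by
  -- Cubic decay in `w` is integrable in the plane, and costs `3 / (1 - δ)` powers of `L ^ (-δ) * w`.
  obtain ⟨k, hk⟩ := exists_nat_ge (3 / (1 - δ))
  have hδ1 : 0 < 1 - δ := by linarith [hδ.2]
  have hk3 : 3 ≤ (1 - δ) * k := by rwa [div_le_iff₀' hδ1] at hk
  obtain ⟨C, hC, hg⟩ := g.exists_norm_pow_mul_norm_le k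
  refine ⟨8 * ((2 * Real.pi) ^ k * C), by positivity, fun L w hL hLw => ?_⟩
  set t := 2 * Real.pi * ‖w‖ with ht
  have hpi : 1 ≤ 2 * Real.pi := by linarith [Real.pi_gt_three]
  have ht1 : 1 ≤ t := hL.trans hLw
  have hwt : ‖w‖ ≤ t := le_mul_of_one_le_left (norm_nonneg _) hpi
  have hnorm : t ^ (1 - δ) ≤ 2 * Real.pi * ‖L ^ (-δ) • w‖ := by
    rw [norm_smul, Real.norm_of_nonneg (by positivity), mul_left_comm, ← ht]
    rw [sub_eq_add_neg, Real.rpow_add (by linarith), Real.rpow_one, mul_comm]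
    gcongr ?_ * t
    exact Real.rpow_le_rpow_of_nonpos (by linarith) hLw (by linarith [hδ.1])
  have h3 : t ^ (3 : ℝ) ≤ (2 * Real.pi) ^ k * ‖L ^ (-δ) • w‖ ^ k := by
    calc t ^ (3 : ℝ) ≤ t ^ ((1 - δ) * k) := Real.rpow_le_rpow_of_exponent_le ht1 hk3
      _ = (t ^ (1 - δ)) ^ k := by rw [Real.rpow_mul (by linarith), Real.rpow_natCast]
      _ ≤ (2 * Real.pi * ‖L ^ (-δ) • w‖) ^ k := by gcongr
      _ = _ := mul_pow _ _ _
  have h4 : t ^ (3 : ℝ) * ‖g (L ^ (-δ) • w)‖ ≤ (2 * Real.pi) ^ k * C := by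
    calc t ^ (3 : ℝ) * ‖g (L ^ (-δ) • w)‖
        ≤ (2 * Real.pi) ^ k * ‖L ^ (-δ) • w‖ ^ k * ‖g (L ^ (-δ) • w)‖ := by gcongr
      _ = (2 * Real.pi) ^ k * (‖L ^ (-δ) • w‖ ^ k * ‖g (L ^ (-δ) • w)‖) := by ring
      _ ≤ _ := by gcongr; exact hg _
  have hw0 := norm_nonneg w
  have h5 : (1 + ‖w‖) ^ (3 : ℝ) ≤ 8 * t ^ (3 : ℝ) := by
    calc (1 + ‖w‖) ^ (3 : ℝ) ≤ (2 * t) ^ (3 : ℝ) := by gcongr; linarith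
      _ = 8 * t ^ (3 : ℝ) := by
        rw [Real.mul_rpow (by norm_num) (by linarith)]; norm_num
  rw [Real.rpow_neg (x := 1 + ‖w‖) (by positivity), ← div_eq_mul_inv, le_div_iff₀ (by positivity),
    mul_comm]
  calc (1 + ‖w‖) ^ (3 : ℝ) * ‖g (L ^ (-δ) • w)‖
      ≤ 8 * t ^ (3 : ℝ) * ‖g (L ^ (-δ) • w)‖ := by gcongr
    _ = 8 * (t ^ (3 : ℝ) * ‖g (L ^ (-δ) • w)‖) := by ring
    _ ≤ _ := by gcongr

/-- The dominated convergence step. Where `2 * π * ‖w‖ ≤ log log n`, the integrand is dominated by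
the Gaussian decay of `zetaCharFun`; elsewhere, by the decay of the test function. -/
lemma tendsto_integral_schwartz_mul_zetaCharFun (g : SchwartzMap ℂ ℂ) {δ : ℝ}
    (hδ : δ ∈ Set.Ioo (0 : ℝ) 1) (z : ℂ) :
    Tendsto (fun n : ℕ => ∫ w : ℂ, g (Real.log (Real.log n) ^ (-δ) • w) *
        (Complex.exp (-(2 * Real.pi * inner ℝ w z : ℝ) * Complex.I) *
          zetaCharFun n ((Real.sqrt (Real.log (Real.log n)))⁻¹ • ((2 * Real.pi : ℝ) • w))))
      atTop (𝓝 (g 0 * (Real.exp (-‖z‖ ^ 2) / Real.pi : ℝ))) := by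
  obtain ⟨M, hM, hgM⟩ := g.exists_norm_pow_mul_norm_le 0
  obtain ⟨C, hC, hgC⟩ := exists_norm_schwartz_le_of_le g hδ
  rw [← integral_exp_neg_pi_sq_mul_cexp z, ← integral_const_mul]
  refine tendsto_integral_filter_of_dominated_convergence
    (fun w => M * Real.exp (-(Real.pi ^ 2 / 8 * ‖w‖ ^ 2)) + C * (1 + ‖w‖) ^ (-3 : ℝ)) ?_ ?_ ?_ ?_
  · refine Eventually.of_forall fun n => ?_
    have h1 : Measurable fun w : ℂ => g (Real.log (Real.log n) ^ (-δ) • w) :=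
      (g.continuous.comp (continuous_const_smul _)).measurable
    have h2 : Measurable fun w : ℂ =>
        zetaCharFun n ((Real.sqrt (Real.log (Real.log n)))⁻¹ • ((2 * Real.pi : ℝ) • w)) :=
      (measurable_zetaCharFun n).comp (by fun_prop)
    exact (h1.mul (Measurable.mul (by fun_prop) h2)).aestronglyMeasurable
  · filter_upwards [eventually_norm_zetaCharFun_le,
      tendsto_log_log_natCast_atTop.eventually_ge_atTop 1] with n hn hL
    refine Eventually.of_forall fun w => ?_
    set L := Real.log (Real.log n) with hLdef
    have hL0 : 0 < L := by linarith
    have hexp : ‖Complex.exp (-(2 * Real.pi * inner ℝ w z : ℝ) * Complex.I)‖ = 1 := by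
      rw [← Complex.ofReal_neg, Complex.norm_exp_ofReal_mul_I]
    rw [norm_mul, norm_mul, hexp, one_mul]
    rcases le_total L (2 * Real.pi * ‖w‖) with hw | hw
    · have h1 := hgC L w hL hw
      have h2 := norm_zetaCharFun_le_one n ((Real.sqrt L)⁻¹ • ((2 * Real.pi : ℝ) • w))
      refine (mul_le_of_le_one_right (norm_nonneg _) h2).trans (h1.trans ?_)
      have : 0 ≤ M * Real.exp (-(Real.pi ^ 2 / 8 * ‖w‖ ^ 2)) := by positivity
      linarith
    · have hnorm : ‖(Real.sqrt L)⁻¹ • ((2 * Real.pi : ℝ) • w)‖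
          = (Real.sqrt L)⁻¹ * (2 * Real.pi * ‖w‖) := by
        rw [norm_smul, norm_smul, Real.norm_of_nonneg (by positivity),
          Real.norm_of_nonneg (by positivity)]
      have h1 : ‖(Real.sqrt L)⁻¹ • ((2 * Real.pi : ℝ) • w)‖ ≤ Real.sqrt L := by
        rw [hnorm, inv_mul_le_iff₀ (by positivity), Real.mul_self_sqrt hL0.le]
        exact hw
      have h2 := hn _ h1
      have e : ‖(Real.sqrt L)⁻¹ • ((2 * Real.pi : ℝ) • w)‖ ^ 2 * L / 32
          = Real.pi ^ 2 / 8 * ‖w‖ ^ 2 := by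
        rw [hnorm, mul_pow, inv_pow, Real.sq_sqrt hL0.le]
        field_simp
        ring
      rw [e] at h2
      have h3 : ‖g (L ^ (-δ) • w)‖ ≤ M := by simpa using hgM (L ^ (-δ) • w)
      have h4 : 0 ≤ C * (1 + ‖w‖) ^ (-3 : ℝ) := by positivity
      have h5 := mul_le_mul h3 h2 (norm_nonneg _) hM.le
      linarith
  · refine ((integrable_exp_neg_mul_norm_sq (by positivity)).const_mul M).add
      ((integrable_one_add_norm ?_).const_mul C)
    rw [Complex.finrank_real_complex]
    norm_num
  · refine Eventually.of_forall fun w => ?_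
    refine Tendsto.mul ?_ (Tendsto.const_mul _ (tendsto_zetaCharFun _))
    have h1 : Tendsto (fun n : ℕ => Real.log (Real.log n) ^ (-δ)) atTop (𝓝 0) :=
      (tendsto_rpow_neg_atTop hδ.1).comp tendsto_log_log_natCast_atTop
    have h2 := h1.smul_const w
    rw [zero_smul] at h2
    exact (g.continuous.tendsto 0).comp h2

/-- The local limit theorem for Schwartz test functions. -/
lemma tendsto_integral_schwartz {Ω : Type*} [MeasurableSpace Ω] {P : Measure Ω}
    [IsProbabilityMeasure P] {U : Nat.Primes → Ω → ℂ}
    (hU_law : ∀ p, HasLaw (U p) uniformCircleLaw P) (hU_indep : iIndepFun U P)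
    {δ : ℝ} (hδ : δ ∈ Set.Ioo (0 : ℝ) 1) (z : ℂ) (f : SchwartzMap ℂ ℂ) :
    Tendsto (fun n : ℕ => ((Real.log (Real.log n) ^ (2 * δ) : ℝ) : ℂ) *
        ∫ ω, f ((Real.log (Real.log n) ^ (1 / 2 - δ))⁻¹ •
          (randomLogZeta U n ω - z * (Real.sqrt (Real.log (Real.log n)) : ℂ))) ∂P)
      atTop (𝓝 ((∫ x, f x) * (Real.exp (-‖z‖ ^ 2) / Real.pi : ℝ))) := by
  have h0 : (𝓕 f) 0 = ∫ x, f x := by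
    rw [SchwartzMap.fourier_coe, Real.fourier_eq']
    simp
  rw [← h0]
  refine (tendsto_integral_schwartz_mul_zetaCharFun (𝓕 f) hδ z).congr' ?_
  filter_upwards [tendsto_log_log_natCast_atTop.eventually_gt_atTop 0] with n hL
  set L := Real.log (Real.log n) with hLdef
  have hX := aemeasurable_randomLogZeta (fun p => (hU_law p).aemeasurable) n
  have := Measure.isProbabilityMeasure_map hX
  have h1 := integral_schwartz_comp_eq (P.map (randomLogZeta U n)) f (z * (Real.sqrt L : ℂ))
    (L ^ (1 / 2 - δ))
  have hcont : Continuous fun x : ℂ => f ((L ^ (1 / 2 - δ))⁻¹ • (x - z * (Real.sqrt L : ℂ))) :=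
    f.continuous.comp (by fun_prop)
  rw [integral_map hX hcont.aestronglyMeasurable] at h1
  rw [h1]
  have h2 := Measure.integral_comp_smul (volume : Measure ℂ) (fun v : ℂ => (𝓕 f) v *
      (Complex.exp (-(2 * Real.pi * inner ℝ v ((L ^ (1 / 2 - δ))⁻¹ • (z * (Real.sqrt L : ℂ))) : ℝ)
          * Complex.I) *
        charFun (P.map (randomLogZeta U n)) ((2 * Real.pi * (L ^ (1 / 2 - δ))⁻¹) • v))) (L ^ (-δ))
  have hjac : |((L ^ (-δ)) ^ Module.finrank ℝ ℂ)⁻¹| = L ^ (2 * δ) := by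
    rw [Complex.finrank_real_complex, abs_of_nonneg (by positivity), ← Real.rpow_natCast,
      ← Real.rpow_mul hL.le, ← Real.rpow_neg hL.le]
    congr 1
    push_cast
    ring
  rw [hjac] at h2
  rw [← Complex.real_smul, ← h2]
  refine integral_congr_ae (Eventually.of_forall fun w => ?_)
  simp only [charFun_randomLogZeta hU_law hU_indep]
  have hscale : L ^ (-δ) * (L ^ (1 / 2 - δ))⁻¹ = (Real.sqrt L)⁻¹ := by
    rw [Real.sqrt_eq_rpow, ← Real.rpow_neg hL.le, ← Real.rpow_neg hL.le, ← Real.rpow_add hL]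
    congr 1
    ring
  have e1 : (2 * Real.pi * (L ^ (1 / 2 - δ))⁻¹) • (L ^ (-δ) • w)
      = (Real.sqrt L)⁻¹ • ((2 * Real.pi : ℝ) • w) := by
    rw [smul_smul, smul_smul, ← hscale]
    congr 1
    ring
  have e2 : inner ℝ (L ^ (-δ) • w) ((L ^ (1 / 2 - δ))⁻¹ • (z * (Real.sqrt L : ℂ)))
      = inner ℝ w z := by
    rw [mul_comm z, ← Complex.real_smul, real_inner_smul_left, real_inner_smul_right,
      real_inner_smul_right, ← mul_assoc, ← mul_assoc, hscale,
      inv_mul_cancel₀ (Real.sqrt_pos.2 hL).ne', one_mul]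
  rw [e1, e2]

/-! ### Jordan measurable sets -/

/-- The local limit theorem for smooth test functions with compact support. -/
lemma tendsto_integral_smooth {Ω : Type*} [MeasurableSpace Ω] {P : Measure Ω}
    [IsProbabilityMeasure P] {U : Nat.Primes → Ω → ℂ}
    (hU_law : ∀ p, HasLaw (U p) uniformCircleLaw P) (hU_indep : iIndepFun U P)
    {δ : ℝ} (hδ : δ ∈ Set.Ioo (0 : ℝ) 1) (z : ℂ) {f : ℂ → ℝ} (hf : ContDiff ℝ (⊤ : ℕ∞) f)
    (hfc : HasCompactSupport f) :
    Tendsto (fun n : ℕ => Real.log (Real.log n) ^ (2 * δ) *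
        ∫ ω, f ((Real.log (Real.log n) ^ (1 / 2 - δ))⁻¹ •
          (randomLogZeta U n ω - z * (Real.sqrt (Real.log (Real.log n)) : ℂ))) ∂P)
      atTop (𝓝 (Real.exp (-‖z‖ ^ 2) / Real.pi * ∫ x, f x)) := by
  have hg : ContDiff ℝ (⊤ : ℕ∞) (fun x => (f x : ℂ)) := Complex.ofRealCLM.contDiff.comp hf
  have hgc : HasCompactSupport (fun x => (f x : ℂ)) := hfc.comp_left Complex.ofReal_zero
  have h := tendsto_integral_schwartz hU_law hU_indep hδ z (hgc.toSchwartzMap hg)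
  have hcoe : ∀ x, hgc.toSchwartzMap hg x = (f x : ℂ) := fun _ => rfl
  simp only [hcoe, integral_complex_ofReal, ← Complex.ofReal_mul] at h
  rw [mul_comm (Real.exp (-‖z‖ ^ 2) / Real.pi)]
  exact tendsto_ofReal_iff.1 h

lemma exists_contDiff_hasCompactSupport_between {K V : Set ℂ} (hK : IsCompact K) (hV : IsOpen V)
    (hKV : K ⊆ V) :
    ∃ f : ℂ → ℝ, ContDiff ℝ (⊤ : ℕ∞) f ∧ HasCompactSupport f ∧
      (∀ x, K.indicator 1 x ≤ f x) ∧ (∀ x, f x ≤ V.indicator 1 x) := by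
  obtain ⟨W, hW, hKW, hWV, hWc⟩ := exists_open_between_and_isCompact_closure hK hV hKV
  obtain ⟨f, hf, hrange, hsupp, hone⟩ := exists_contMDiff_support_eq_eq_one_iff
    (modelWithCornersSelf ℝ ℂ) (n := (⊤ : ℕ∞)) hW hK.isClosed hKW
  have h01 : ∀ x, f x ∈ Set.Icc (0 : ℝ) 1 := fun x => hrange (Set.mem_range_self x)
  refine ⟨f, hf.contDiff, ?_, fun x => ?_, fun x => ?_⟩
  · rw [HasCompactSupport, tsupport, hsupp]
    exact hWc
  · exact Set.indicator_le' (fun y hy => ((hone y).1 hy).ge) (fun y _ => (h01 y).1) x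
  · by_cases hx : x ∈ V
    · rw [Set.indicator_of_mem hx]
      exact (h01 x).2
    · have : x ∉ Function.support f := fun h => hx (hWV (subset_closure (hsupp ▸ h)))
      rw [Set.indicator_of_notMem hx, Function.notMem_support.1 this]

lemma integral_indicator_one_of_nullMeasurableSet {Ω : Type*} [MeasurableSpace Ω] {P : Measure Ω}
    {s : Set Ω} (hs : NullMeasurableSet s P) : ∫ ω, s.indicator 1 ω ∂P = P.real s := by
  rw [integral_indicator₀ hs]
  simp

lemma integral_comp_le_measureReal {Ω E : Type*} [MeasurableSpace Ω] {P : Measure Ω}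
    [IsFiniteMeasure P] [TopologicalSpace E] [MeasurableSpace E] [BorelSpace E] {Y : Ω → E}
    (hY : AEMeasurable Y P) {f : E → ℝ} (hf0 : ∀ x, 0 ≤ f x)
    {V : Set E} (hV : IsOpen V) (hfV : ∀ x, f x ≤ V.indicator 1 x) :
    ∫ ω, f (Y ω) ∂P ≤ P.real {ω | Y ω ∈ V} := by
  have hm : NullMeasurableSet {ω | Y ω ∈ V} P := hY.nullMeasurableSet_preimage hV.measurableSet
  rw [← integral_indicator_one_of_nullMeasurableSet hm]
  refine integral_mono_of_nonneg (Eventually.of_forall fun ω => hf0 _)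
    ((integrable_const 1).indicator₀ hm) (Eventually.of_forall fun ω => ?_)
  exact hfV (Y ω)

lemma measureReal_le_integral_comp {Ω E : Type*} [MeasurableSpace Ω] {P : Measure Ω}
    [IsFiniteMeasure P] [TopologicalSpace E] [MeasurableSpace E] [BorelSpace E] {Y : Ω → E}
    (hY : AEMeasurable Y P) {f : E → ℝ} (hf : Continuous f) (hf1 : ∀ x, f x ≤ 1)
    {K : Set E} (hK : IsClosed K) (hfK : ∀ x, K.indicator 1 x ≤ f x) :
    P.real {ω | Y ω ∈ K} ≤ ∫ ω, f (Y ω) ∂P := by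
  have hm : NullMeasurableSet {ω | Y ω ∈ K} P := hY.nullMeasurableSet_preimage hK.measurableSet
  have h0 : ∀ x, 0 ≤ f x := fun x => (Set.indicator_nonneg (fun _ _ => zero_le_one) x).trans (hfK x)
  rw [← integral_indicator_one_of_nullMeasurableSet hm]
  refine integral_mono ((integrable_const 1).indicator₀ hm) ?_ fun ω => hfK (Y ω)
  refine Integrable.of_bound (hf.measurable.comp_aemeasurable hY).aestronglyMeasurable 1
    (Eventually.of_forall fun ω => ?_)
  rw [Real.norm_of_nonneg (h0 _)]
  exact hf1 _

theorem mainTheorem9 {Ω : Type*} [MeasurableSpace Ω] (P : Measure Ω) [IsProbabilityMeasure P]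
    (U : Nat.Primes → Ω → ℂ)
    (hU_law : ∀ p, HasLaw (U p) uniformCircleLaw P)
    (hU_indep : iIndepFun U P)
    (δ : ℝ) (hδ : δ ∈ Set.Ioo (0 : ℝ) 1) (z : ℂ)
    (B : Set ℂ) (hB : IsJordanMeasurable B) (hB_pos : 0 < volume B) :
    Tendsto
      (fun n : ℕ =>
        (Real.log (Real.log n)) ^ (2 * δ) *
          P.real {ω | randomLogZeta U n ω - z * (Real.sqrt (Real.log (Real.log n)) : ℂ) ∈
            ((Real.log (Real.log n)) ^ (1 / 2 - δ) : ℝ) • B})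
      atTop
      (𝓝 (Real.exp (-‖z‖ ^ 2) / Real.pi * volume.real B)) := by
  set c := Real.exp (-‖z‖ ^ 2) / Real.pi with hc
  have hc0 : 0 < c := by positivity
  set Y : ℕ → Ω → ℂ := fun n ω => (Real.log (Real.log n) ^ (1 / 2 - δ))⁻¹ •
    (randomLogZeta U n ω - z * (Real.sqrt (Real.log (Real.log n)) : ℂ)) with hYdef
  have hY : ∀ n, AEMeasurable (Y n) P := fun n =>
    ((aemeasurable_randomLogZeta (fun p => (hU_law p).aemeasurable) n).sub_const _).const_smul
      (Real.log (Real.log n) ^ (1 / 2 - δ))⁻¹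
  have hfin : volume B ≠ ⊤ := hB.bounded.measure_lt_top.ne
  have hBreal : 0 < volume.real B := ENNReal.toReal_pos hB_pos.ne' hfin
  have hcl : volume (closure B) = volume B := measure_closure_of_null_frontier hB.volume_frontier
  have hint : volume (interior B) = volume B := measure_interior_of_null_frontier hB.volume_frontier
  have hset : ∀ᶠ n : ℕ in atTop, 0 ≤ Real.log (Real.log n) ^ (2 * δ) ∧
      {ω | randomLogZeta U n ω - z * (Real.sqrt (Real.log (Real.log n)) : ℂ) ∈
        ((Real.log (Real.log n)) ^ (1 / 2 - δ) : ℝ) • B} = {ω | Y n ω ∈ B} := by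
    filter_upwards [tendsto_log_log_natCast_atTop.eventually_gt_atTop 0] with n hn
    refine ⟨by positivity, Set.ext fun ω => ?_⟩
    exact Set.mem_smul_set_iff_inv_smul_mem₀ (Real.rpow_pos_of_pos hn _).ne' _ _
  -- The indicator of `B` is squeezed between smooth compactly supported functions: from below by one
  -- that equals `1` on a compact subset of the interior, from above by one that equals `1` on the
  -- closure. The boundary is negligible, so both can have integral close to the area of `B`.
  refine tendsto_order.2 ⟨fun a ha => ?_, fun b hb => ?_⟩
  · have h1 : ENNReal.ofReal (a / c) < volume (interior B) := by
      rw [hint, ← ENNReal.ofReal_toReal hfin]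
      exact (ENNReal.ofReal_lt_ofReal_iff hBreal).2 ((div_lt_iff₀' hc0).2 ha)
    obtain ⟨K, hKB, hK, haK⟩ := isOpen_interior.exists_lt_isCompact h1
    obtain ⟨f, hf, hfc, hKf, hfB⟩ :=
      exists_contDiff_hasCompactSupport_between hK isOpen_interior hKB
    have h0 : ∀ x, 0 ≤ f x := fun x =>
      (Set.indicator_nonneg (fun _ _ => zero_le_one) x).trans (hKf x)
    have h2 : volume.real K ≤ ∫ x, f x := by
      rw [← integral_indicator_one hK.measurableSet]
      exact integral_mono ((integrable_indicator_iff hK.measurableSet).2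
        (integrableOn_const hK.measure_lt_top.ne))
        (hf.continuous.integrable_of_hasCompactSupport hfc) hKf
    have h3 : a < c * ∫ x, f x := by
      have h4 : a / c < volume.real K := not_le.1 fun h => haK.not_ge
        ((ENNReal.ofReal_toReal hK.measure_lt_top.ne).ge.trans (ENNReal.ofReal_le_ofReal h))
      exact (div_lt_iff₀' hc0).1 (h4.trans_le h2)
    filter_upwards [(tendsto_integral_smooth hU_law hU_indep hδ z hf hfc).eventually_const_lt h3,
      hset] with n hn hs
    rw [hs.2]
    refine hn.trans_le (mul_le_mul_of_nonneg_left ?_ hs.1)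
    exact (integral_comp_le_measureReal (hY n) h0 isOpen_interior hfB).trans
      (measureReal_mono fun ω (hω : Y n ω ∈ interior B) => interior_subset (s := B) hω)
  · have h1 : volume (closure B) < ENNReal.ofReal (b / c) := by
      rw [hcl, ← ENNReal.ofReal_toReal hfin]
      have h2 := (lt_div_iff₀' hc0).2 hb
      exact (ENNReal.ofReal_lt_ofReal_iff (hBreal.trans h2)).2 h2
    obtain ⟨V, hBV, hV, hVb⟩ := (closure B).exists_isOpen_lt_of_lt _ h1
    obtain ⟨f, hf, hfc, hBf, hfV⟩ :=
      exists_contDiff_hasCompactSupport_between hB.bounded.isCompact_closure hV hBV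
    have h2 : ∫ x, f x ≤ volume.real V := by
      rw [← integral_indicator_one hV.measurableSet]
      exact integral_mono (hf.continuous.integrable_of_hasCompactSupport hfc)
        ((integrable_indicator_iff hV.measurableSet).2 (integrableOn_const (hVb.trans_le le_top).ne))
        hfV
    have h3 : c * ∫ x, f x < b := by
      have h4 : volume.real V < b / c := ENNReal.toReal_lt_of_lt_ofReal hVb
      exact (lt_div_iff₀' hc0).1 (h2.trans_lt h4)
    filter_upwards [(tendsto_integral_smooth hU_law hU_indep hδ z hf hfc).eventually_lt_const h3,
      hset] with n hn hs
    rw [hs.2]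
    refine (mul_le_mul_of_nonneg_left ?_ hs.1).trans_lt hn
    have h5 : P.real {ω | Y n ω ∈ B} ≤ P.real {ω | Y n ω ∈ closure B} :=
      measureReal_mono fun ω (hω : Y n ω ∈ B) => subset_closure hω
    exact h5.trans (measureReal_le_integral_comp (hY n) hf.continuous
      (fun x => (hfV x).trans (Set.indicator_le_self' (fun _ _ => zero_le_one) x))
      isClosed_closure hBf)
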